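/- For $j\ge 0$ let $h_j=\mathrm{He}_j/\sqrt{j!}$ be the $j$-th (probabilists') Hermite polynomial, normalized to have norm $1$ in $L^2(\mathcal N(0,1))$. For a finite multiset $I$ of elements of $\{1,\dots,n\}$ let $|I|$ be its size counted with multiplicity, let $I_k$ be the multiplicity of $k$ in $I$, and put $h_I(x_1,\dots,x_n)=\prod_{k=1}^n h_{I_k}(x_k)$. Given points $p_1,\dots,p_m\in\mathbb R^n$, let $H$ be the matrix with rows indexed by the multisets $I$ with $0<|I|\le d$, columns indexed by $i\in\{1,\dots,m\}$, and entries $H_{I,i}=h_I(p_i)$; let $\|H\|$ be its spectral norm ($\ell^2\to\ell^2$ operator norm). Theorem. For every integer $d\ge 0$ there are constants $C>0$ and $k\in\mathbb N$, depending only on $d$, such that for all $\delta>0$ and all $\beta>0$ there is an $N$ such that for all $n\ge N$ and all integers $m\ge 0$ with $m\le n^{d-\delta}$, if $p_1,\dots,p_m$ are independent random points of $\mathbb R^n$, each with distribution $\mathcal N(0,\mathrm{Id})$, then $$\Pr\left[\,\|H\|\le C(\log n)^k\, n^{d/2}\right]\ \ge\ 1-n^{-\beta}.$$ In other words, if $m\le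 n^{d-\delta}$ and $n$ is sufficiently large, then with high probability $\|H\|=\tilde O(n^{d/2})$. -/

import Mathlib

open MeasureTheory ProbabilityTheory
open scoped Matrix.Norms.L2Operator

/-- The normalized (probabilists') Hermite polynomial `h_j = He_j / √(j!)`, as a function on `ℝ`.
Since `∫ He_j ^ 2 dN(0,1) = j!`, it has norm `1` in `L²(N(0,1))`. -/
noncomputable def normHermite (j : ℕ) (x : ℝ) : ℝ :=
  Polynomial.aeval x (Polynomial.hermite j) / Real.sqrt (j.factorial : ℝ)

/-- The multi-sets `I` of elements of an `n`-element set with `0 < |I| ≤ d`,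
where `|I|` counts multiplicities. -/
abbrev MultiIndex (n d : ℕ) : Type :=
  {I : Multiset (Fin n) // 0 < I.card ∧ I.card ≤ d}

instance MultiIndex.instFinite (n d : ℕ) : Finite (MultiIndex n d) := by
  refine Finite.of_injective
    (fun (I : MultiIndex n d) (k : Fin n) =>
      (⟨I.1.count k, Nat.lt_succ_of_le ((Multiset.count_le_card k I.1).trans I.2.2)⟩ :
        Fin (d + 1))) ?_
  intro I J h
  apply Subtype.ext
  ext k
  exact congrArg Fin.val (congrFun h k)

noncomputable instance MultiIndex.instFintype (n d : ℕ) : Fintype (MultiIndex n d) :=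
  Fintype.ofFinite _

/-- The multivariate Hermite polynomial `h_I(x_1, …, x_n) = ∏ k, h_{I_k}(x_k)`, where `I_k` is
the multiplicity of `k` in `I`. -/
noncomputable def multiHermite {n : ℕ} (I : Multiset (Fin n)) (x : EuclideanSpace ℝ (Fin n)) : ℝ :=
  ∏ k : Fin n, normHermite (I.count k) (x k)

/-- The matrix `H` with rows indexed by the multi-sets `I` with `0 < |I| ≤ d`, columns indexed by
the points, and entries `H_{I,i} = h_I(p_i)`. -/
noncomputable def hermiteMatrix {n m : ℕ} (d : ℕ) (p : Fin m → EuclideanSpace ℝ (Fin n)) :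
    Matrix (MultiIndex n d) (Fin m) ℝ :=
  Matrix.of fun I i => multiHermite I.1 (p i)

/-- The law of `m` independent points of `ℝⁿ`, each with distribution `N(0, Id)`. -/
noncomputable def gaussianPoints (n m : ℕ) : Measure (Fin m → EuclideanSpace ℝ (Fin n)) :=
  Measure.pi fun _ => stdGaussian (EuclideanSpace ℝ (Fin n))

/-! The matrix `H Hᵀ` is a sum of independent rank-one matrices, and a matrix Chernoff bound
applies, with the trace of the exponential replaced by its Taylor polynomial `truncExp Q`, so that
only traces of powers occur.

For `A ≥ 0` and `|v| ≤ 1`, adding `v vᵀ` to `A` raises `tr (truncExp Q A)` by at most `2 vᵀ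
(truncExp Q A) v` (`Matrix.PosSemidef.trace_truncExp_add_vecMulVec_le`). If `E[v vᵀ] ≤ ε Id`,
averaging over one new point costs a factor `1 + 2ε`; hence the expected trace after `m` points is
at most `(1 + 2ε)^m` times the dimension. The term of degree `Q` and Markov's inequality turn this
into a tail bound with factor `Q! / s^Q` (`measure_exists_lt_dotProduct_sumRankOne_le`).

The Hermite features are orthonormal, so their second moment is `Id`, but they are unbounded. They
are cut off outside the box `|x_k| ≤ T = log n` and divided by `√L`, where `L` is `n^d` up to
logarithms; then `|v| ≤ 1` and `ε = 1/L`. Since `m ≤ L`, the growth factor is at most `e²`. With `s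
= T²` and `Q = ⌈T⌉` the factor `Q! / s^Q` beats every fixed power of `n`, and so does the chance
that a point leaves the box. Otherwise `‖H‖² ≤ L T²`. -/

/-! ### Spectral weights, Chebyshev's inequality and the truncated exponential -/

open scoped Matrix in
/-- The quadratic forms and the traces of the powers of a positive semidefinite matrix, in terms of
its eigenvalues `l` and of the spectral weights `w` of a vector. -/
theorem Matrix.PosSemidef.exists_spectral_weights {ι : Type*} [Fintype ι] [DecidableEq ι]
    {A : Matrix ι ι ℝ} (hA : A.PosSemidef) (v : ι → ℝ) :
    ∃ l w : ι → ℝ, (∀ k, 0 ≤ l k) ∧ (∀ k, 0 ≤ w k) ∧ ∑ k, w k = v ⬝ᵥ v ∧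
      (∀ s : ℕ, v ⬝ᵥ (A ^ s) *ᵥ v = ∑ k, w k * l k ^ s) ∧
      ∀ s : ℕ, (A ^ s).trace = ∑ k, l k ^ s := by
  set U : Matrix ι ι ℝ := (hA.1.eigenvectorUnitary : Matrix ι ι ℝ) with hU
  set D : Matrix ι ι ℝ := Matrix.diagonal hA.1.eigenvalues with hD
  have hUU : Uᵀ * U = 1 := by
    have := Unitary.coe_star_mul_self hA.1.eigenvectorUnitary
    rwa [Matrix.star_eq_conjTranspose, Matrix.conjTranspose_eq_transpose_of_trivial] at this
  have hUU' : U * Uᵀ = 1 := mul_eq_one_comm.mp hUU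
  have hAD : A = U * D * Uᵀ := by
    have := hA.1.spectral_theorem
    rw [Unitary.conjStarAlgAut_apply, Matrix.star_eq_conjTranspose,
      Matrix.conjTranspose_eq_transpose_of_trivial] at this
    exact this
  have hpow : ∀ s : ℕ, A ^ s = U * D ^ s * Uᵀ := by
    intro s
    induction s with
    | zero => simp [hUU']
    | succ s ih =>
      rw [pow_succ, ih, pow_succ]
      conv_lhs => rw [hAD]
      calc U * D ^ s * Uᵀ * (U * D * Uᵀ) = U * D ^ s * (Uᵀ * U) * D * Uᵀ := by
            simp only [Matrix.mul_assoc]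
        _ = _ := by rw [hUU]; simp only [Matrix.mul_assoc, Matrix.one_mul]
  have hquad : ∀ B : Matrix ι ι ℝ, v ⬝ᵥ (U * B * Uᵀ) *ᵥ v = (Uᵀ *ᵥ v) ⬝ᵥ B *ᵥ (Uᵀ *ᵥ v) := by
    intro B
    rw [← Matrix.mulVec_mulVec, ← Matrix.mulVec_mulVec, Matrix.dotProduct_mulVec,
      Matrix.mulVec_transpose U v]
  refine ⟨hA.1.eigenvalues, fun k => (Uᵀ *ᵥ v) k ^ 2, hA.eigenvalues_nonneg, fun k => sq_nonneg _,
    ?_, fun s => ?_, fun s => ?_⟩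
  · have := hquad 1
    rw [Matrix.mul_one, hUU', Matrix.one_mulVec, Matrix.one_mulVec] at this
    rw [this]
    simp only [dotProduct, sq]
  · rw [hpow, hquad, hD, Matrix.diagonal_pow]
    simp only [dotProduct, Matrix.mulVec_diagonal, Pi.pow_apply]
    exact Finset.sum_congr rfl fun k _ => by ring
  · rw [hpow, Matrix.trace_mul_comm, ← Matrix.mul_assoc, hUU, Matrix.one_mul, hD,
      Matrix.diagonal_pow, Matrix.trace_diagonal]
    rfl

/-- Chebyshev's sum inequality with nonnegative weights of total mass at most one. -/
theorem sum_weight_mul_sum_weight_le {ι : Type*} [Fintype ι] {w f g : ι → ℝ}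
    (hw : ∀ k, 0 ≤ w k) (hw1 : ∑ k, w k ≤ 1) (hf : ∀ k, 0 ≤ f k) (hg : ∀ k, 0 ≤ g k)
    (hfg : Monovary f g) :
    (∑ k, w k * f k) * (∑ k, w k * g k) ≤ ∑ k, w k * (f k * g k) := by
  -- Symmetrization: each product of differences is nonnegative because `f` and `g` are ordered
  -- alike.
  have h0 : 0 ≤ ∑ k, ∑ l, w k * w l * ((f k - f l) * (g k - g l)) := by
    refine Finset.sum_nonneg fun k _ => Finset.sum_nonneg fun l _ => ?_
    refine mul_nonneg (mul_nonneg (hw k) (hw l)) ?_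
    rcases lt_trichotomy (g k) (g l) with h | h | h
    · nlinarith [hfg h]
    · simp [h]
    · nlinarith [hfg h]
  have h1 : ∑ k, ∑ l, w k * w l * ((f k - f l) * (g k - g l)) =
      2 * ((∑ k, w k) * ∑ k, w k * (f k * g k)) -
        2 * ((∑ k, w k * f k) * (∑ k, w k * g k)) := by
    have e : ∀ a b : ι → ℝ, (∑ k, a k) * (∑ k, b k) = ∑ k, ∑ l, a k * b l := fun a b =>
      Finset.sum_mul_sum _ _ _ _
    have e1 := e w (fun k => w k * (f k * g k))
    have e2 := e (fun k => w k * (f k * g k)) w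
    have e3 := e (fun k => w k * f k) (fun k => w k * g k)
    have e4 := e (fun k => w k * g k) (fun k => w k * f k)
    have : ∑ k, ∑ l, w k * w l * ((f k - f l) * (g k - g l)) =
        (∑ k, ∑ l, w k * (w l * (f l * g l))) + (∑ k, ∑ l, w k * (f k * g k) * w l) -
        ((∑ k, ∑ l, w k * f k * (w l * g l)) + ∑ k, ∑ l, w k * g k * (w l * f l)) := by
      simp only [← Finset.sum_add_distrib, ← Finset.sum_sub_distrib]
      exact Finset.sum_congr rfl fun k _ => Finset.sum_congr rfl fun l _ => by ring
    rw [this, ← e1, ← e2, ← e3, ← e4]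
    ring
  -- Needed because the total mass may be less than one.
  have h2 : 0 ≤ ∑ k, w k * (f k * g k) :=
    Finset.sum_nonneg fun k _ => mul_nonneg (hw k) (mul_nonneg (hf k) (hg k))
  nlinarith

/-- The exponential series of a matrix, truncated after the term of degree `Q`. -/
noncomputable def Matrix.truncExp {ι : Type*} [Fintype ι] [DecidableEq ι] (Q : ℕ)
    (A : Matrix ι ι ℝ) : Matrix ι ι ℝ :=
  ∑ q ∈ Finset.range (Q + 1), ((q.factorial : ℝ)⁻¹) • A ^ q

/-- A truncated form of `e^(1+x) = e · e^x`: the left side is the part `s + r ≤ Q` of the product of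
the series `x^s/s!` and `1/r!`, and every partial sum of the latter is below `e < 3`. -/
theorem sum_range_one_add_pow_div_factorial_le (Q : ℕ) {x : ℝ} (hx : 0 ≤ x) :
    ∑ q ∈ Finset.range (Q + 1), (q.factorial : ℝ)⁻¹ * (1 + x) ^ q ≤
      3 * ∑ q ∈ Finset.range (Q + 1), (q.factorial : ℝ)⁻¹ * x ^ q := by
  have h1 : ∀ q : ℕ, (q.factorial : ℝ)⁻¹ * (1 + x) ^ q = ∑ s ∈ Finset.range (q + 1),
      ((s.factorial : ℝ)⁻¹ * x ^ s) * ((q - s).factorial : ℝ)⁻¹ := by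
    intro q
    rw [add_comm, add_pow, Finset.mul_sum]
    refine Finset.sum_congr rfl fun s hs => ?_
    have hs' : s ≤ q := Nat.lt_succ_iff.mp (Finset.mem_range.mp hs)
    rw [Nat.cast_choose ℝ hs', one_pow]
    have := Nat.cast_ne_zero (R := ℝ).mpr q.factorial_ne_zero
    field_simp
  have h2 : ∀ N : ℕ, ∑ s ∈ Finset.range N, (s.factorial : ℝ)⁻¹ ≤ 3 := by
    intro N
    have := Real.sum_le_exp_of_nonneg (x := 1) zero_le_one N
    simp only [one_pow, one_div] at this
    exact this.trans Real.exp_one_lt_three.le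
  calc _ = ∑ q ∈ Finset.range (Q + 1), ∑ s ∈ Finset.range (q + 1),
      ((s.factorial : ℝ)⁻¹ * x ^ s) * ((q - s).factorial : ℝ)⁻¹ :=
        Finset.sum_congr rfl fun q _ => h1 q
    _ = ∑ s ∈ Finset.range (Q + 1), ∑ r ∈ Finset.range (Q + 1 - s),
      ((s.factorial : ℝ)⁻¹ * x ^ s) * (r.factorial : ℝ)⁻¹ :=
        Finset.sum_range_diag_flip (Q + 1)
          fun s r => ((s.factorial : ℝ)⁻¹ * x ^ s) * (r.factorial : ℝ)⁻¹
    _ ≤ ∑ s ∈ Finset.range (Q + 1), ((s.factorial : ℝ)⁻¹ * x ^ s) * 3 := by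
        refine Finset.sum_le_sum fun s _ => ?_
        rw [← Finset.mul_sum]
        exact mul_le_mul_of_nonneg_left (h2 _) (by positivity)
    _ = _ := by rw [← Finset.sum_mul, mul_comm]

/-! ### Rank-one perturbations -/

section RankOne

open scoped Matrix

variable {ι : Type*} [Fintype ι] [DecidableEq ι]

theorem Matrix.trace_truncExp (Q : ℕ) (A : Matrix ι ι ℝ) :
    (truncExp Q A).trace =
      ∑ q ∈ Finset.range (Q + 1), (q.factorial : ℝ)⁻¹ * (A ^ q).trace := by
  simp [truncExp, Matrix.trace_sum, Matrix.trace_smul]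

theorem Matrix.dotProduct_truncExp_mulVec (Q : ℕ) (A : Matrix ι ι ℝ) (v : ι → ℝ) :
    v ⬝ᵥ (truncExp Q A) *ᵥ v =
      ∑ q ∈ Finset.range (Q + 1), (q.factorial : ℝ)⁻¹ * (v ⬝ᵥ (A ^ q) *ᵥ v) := by
  simp [truncExp, Matrix.sum_mulVec, Matrix.smul_mulVec, dotProduct_sum, dotProduct_smul]

theorem Matrix.PosSemidef.truncExp (Q : ℕ) {A : Matrix ι ι ℝ} (hA : A.PosSemidef) :
    (truncExp Q A).PosSemidef := by
  unfold Matrix.truncExp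
  refine Matrix.posSemidef_sum _ fun q _ => ?_
  exact (hA.pow q).smul (by positivity)

omit [Fintype ι] [DecidableEq ι] in
theorem monovary_pow_one_add_pow {l : ι → ℝ} (hl : ∀ k, 0 ≤ l k) (r i : ℕ) :
    Monovary (fun k => l k ^ r) (fun k => (1 + l k) ^ i) := by
  intro a b hab
  have : l a ≤ l b := by
    by_contra! h
    exact absurd hab (not_lt.mpr (pow_le_pow_left₀ (by linarith [hl b]) (by linarith) i))
  exact pow_le_pow_left₀ (hl a) this r

/-- Seen from `v`, the perturbation `v vᵀ` acts at worst like the shift `l ↦ 1 + l` of the spectrum.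
Expanding one factor `A + v vᵀ` either adds a power to `A ^ r`, which is why `r` is general, or
splits the form into a product of two forms, which Chebyshev's inequality merges. -/
theorem dotProduct_add_vecMulVec_pow_le {A : Matrix ι ι ℝ} {v l w : ι → ℝ}
    (hl : ∀ k, 0 ≤ l k) (hw : ∀ k, 0 ≤ w k) (hw1 : ∑ k, w k ≤ 1)
    (hA : ∀ s : ℕ, v ⬝ᵥ (A ^ s) *ᵥ v = ∑ k, w k * l k ^ s) (i : ℕ) :
    ∀ r : ℕ, v ⬝ᵥ (A ^ r * (A + Matrix.vecMulVec v v) ^ i) *ᵥ v ≤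
      ∑ k, w k * (l k ^ r * (1 + l k) ^ i) := by
  induction i with
  | zero => intro r; simp [hA]
  | succ i ih =>
    intro r
    have hsplit : v ⬝ᵥ (A ^ r * (A + Matrix.vecMulVec v v) ^ (i + 1)) *ᵥ v =
        v ⬝ᵥ (A ^ (r + 1) * (A + Matrix.vecMulVec v v) ^ i) *ᵥ v +
          (v ⬝ᵥ (A ^ r) *ᵥ v) * (v ⬝ᵥ (A ^ 0 * (A + Matrix.vecMulVec v v) ^ i) *ᵥ v) := by
      rw [pow_succ', ← Matrix.mul_assoc, Matrix.mul_add, Matrix.add_mul, Matrix.add_mulVec,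
        dotProduct_add, ← pow_succ, pow_zero, Matrix.one_mul]
      congr 1
      rw [← Matrix.mulVec_mulVec, ← Matrix.mulVec_mulVec, Matrix.vecMulVec_mulVec,
        op_smul_eq_smul, Matrix.mulVec_smul, dotProduct_smul, smul_eq_mul, mul_comm]
    have hr : 0 ≤ v ⬝ᵥ (A ^ r) *ᵥ v := by
      rw [hA]
      exact Finset.sum_nonneg fun k _ => mul_nonneg (hw k) (pow_nonneg (hl k) r)
    have hcheb := sum_weight_mul_sum_weight_le hw hw1 (fun k => pow_nonneg (hl k) r)
      (fun k => pow_nonneg (by linarith [hl k]) i) (monovary_pow_one_add_pow hl r i)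
    have h0 := ih 0
    simp only [pow_zero (l _), one_mul] at h0
    calc _ ≤ ∑ k, w k * (l k ^ (r + 1) * (1 + l k) ^ i) +
          (∑ k, w k * l k ^ r) * ∑ k, w k * (1 + l k) ^ i := by
          rw [hsplit, ← hA r]
          exact add_le_add (ih _) (mul_le_mul_of_nonneg_left h0 hr)
      _ ≤ ∑ k, w k * (l k ^ (r + 1) * (1 + l k) ^ i) +
          ∑ k, w k * (l k ^ r * (1 + l k) ^ i) := by gcongr
      _ = _ := by
          rw [← Finset.sum_add_distrib]
          exact Finset.sum_congr rfl fun k _ => by ring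

/-- Factors are peeled off one at a time; each leaves a quadratic form at `v`, bounded by the
previous lemma, and the bounds telescope. Carrying `A ^ r` along avoids any need for `A` and `v vᵀ`
to commute. -/
theorem trace_add_vecMulVec_pow_le {A : Matrix ι ι ℝ} {v l w : ι → ℝ}
    (hl : ∀ k, 0 ≤ l k) (hw : ∀ k, 0 ≤ w k) (hw1 : ∑ k, w k ≤ 1)
    (hA : ∀ s : ℕ, v ⬝ᵥ (A ^ s) *ᵥ v = ∑ k, w k * l k ^ s) (q : ℕ) :
    ∀ r : ℕ, ((A + Matrix.vecMulVec v v) ^ q * A ^ r).trace ≤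
      (A ^ (r + q)).trace + ∑ k, w k * (l k ^ r * ((1 + l k) ^ q - l k ^ q)) := by
  induction q with
  | zero => intro r; simp
  | succ q ih =>
    intro r
    have hsplit : ((A + Matrix.vecMulVec v v) ^ (q + 1) * A ^ r).trace =
        ((A + Matrix.vecMulVec v v) ^ q * A ^ (r + 1)).trace +
          v ⬝ᵥ (A ^ r * (A + Matrix.vecMulVec v v) ^ q) *ᵥ v := by
      have hcomm : ((A + Matrix.vecMulVec v v) ^ (q + 1) * A ^ r).trace =
          ((A + Matrix.vecMulVec v v) ^ q * A ^ (r + 1)).trace +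
          ((A + Matrix.vecMulVec v v) ^ q * (Matrix.vecMulVec v v * A ^ r)).trace := by
        rw [pow_succ, Matrix.mul_assoc, Matrix.add_mul, Matrix.mul_add, Matrix.trace_add,
          ← pow_succ']
      rw [hcomm, Matrix.vecMulVec_mul, Matrix.mul_vecMulVec, Matrix.trace_vecMulVec,
        dotProduct_comm, ← Matrix.dotProduct_mulVec, Matrix.mulVec_mulVec]
    have := dotProduct_add_vecMulVec_pow_le hl hw hw1 hA q r
    rw [hsplit]
    calc _ ≤ (A ^ (r + 1 + q)).trace + ∑ k, w k * (l k ^ (r + 1) * ((1 + l k) ^ q - l k ^ q)) +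
          ∑ k, w k * (l k ^ r * (1 + l k) ^ q) := add_le_add (ih _) this
      _ = _ := by
          rw [add_assoc, ← Finset.sum_add_distrib, add_assoc r 1 q, add_comm 1 q]
          congr 1
          exact Finset.sum_congr rfl fun k _ => by ring

/-- A rank-one perturbation increases the trace of the truncated exponential by at most twice the
quadratic form of the truncated exponential. -/
theorem Matrix.PosSemidef.trace_truncExp_add_vecMulVec_le (Q : ℕ) {A : Matrix ι ι ℝ}
    (hA : A.PosSemidef) {v : ι → ℝ} (hv : v ⬝ᵥ v ≤ 1) :
    (Matrix.truncExp Q (A + Matrix.vecMulVec v v)).trace ≤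
      (Matrix.truncExp Q A).trace + 2 * (v ⬝ᵥ (Matrix.truncExp Q A) *ᵥ v) := by
  obtain ⟨l, w, hl, hw, hwv, hquad, -⟩ := hA.exists_spectral_weights v
  have hw1 : ∑ k, w k ≤ 1 := hwv ▸ hv
  rw [trace_truncExp, trace_truncExp, dotProduct_truncExp_mulVec]
  have h1 : ∀ q : ℕ, ((A + Matrix.vecMulVec v v) ^ q).trace ≤
      (A ^ q).trace + ∑ k, w k * ((1 + l k) ^ q - l k ^ q) := by
    intro q
    simpa using trace_add_vecMulVec_pow_le hl hw hw1 hquad q 0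
  calc _ ≤ ∑ q ∈ Finset.range (Q + 1), (q.factorial : ℝ)⁻¹ *
        ((A ^ q).trace + ∑ k, w k * ((1 + l k) ^ q - l k ^ q)) :=
        Finset.sum_le_sum fun q _ => mul_le_mul_of_nonneg_left (h1 q) (by positivity)
    _ = ∑ q ∈ Finset.range (Q + 1), (q.factorial : ℝ)⁻¹ * (A ^ q).trace +
        ∑ k, w k * (∑ q ∈ Finset.range (Q + 1), (q.factorial : ℝ)⁻¹ * (1 + l k) ^ q -
          ∑ q ∈ Finset.range (Q + 1), (q.factorial : ℝ)⁻¹ * l k ^ q) := by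
        simp only [mul_add, Finset.sum_add_distrib]
        congr 1
        simp only [← Finset.sum_sub_distrib, Finset.mul_sum]
        rw [Finset.sum_comm]
        exact Finset.sum_congr rfl fun k _ => Finset.sum_congr rfl fun q _ => by ring
    _ ≤ ∑ q ∈ Finset.range (Q + 1), (q.factorial : ℝ)⁻¹ * (A ^ q).trace +
        ∑ k, w k * (2 * ∑ q ∈ Finset.range (Q + 1), (q.factorial : ℝ)⁻¹ * l k ^ q) := by
        -- The constant `2` is `3 - 1`, from `sum_range_one_add_pow_div_factorial_le`.
        refine add_le_add_right (Finset.sum_le_sum fun k _ => ?_) _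
        exact mul_le_mul_of_nonneg_left
          (by linarith [sum_range_one_add_pow_div_factorial_le Q (hl k)]) (hw k)
    _ = _ := by
        congr 1
        simp only [hquad, Finset.mul_sum]
        rw [Finset.sum_comm]
        exact Finset.sum_congr rfl fun k _ => Finset.sum_congr rfl fun q _ => by ring

/-- Powers of the quadratic form of a positive semidefinite matrix at a unit vector are controlled
by the trace of the truncated exponential. -/
theorem Matrix.PosSemidef.pow_dotProduct_le_trace_truncExp {Q : ℕ}
    {A : Matrix ι ι ℝ} (hA : A.PosSemidef) {v : ι → ℝ} (hv : v ⬝ᵥ v = 1) :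
    (v ⬝ᵥ A *ᵥ v) ^ Q ≤ Q.factorial * (Matrix.truncExp Q A).trace := by
  obtain ⟨l, w, hl, hw, hwv, hquad, htr⟩ := hA.exists_spectral_weights v
  have hw1 : ∑ k, w k = 1 := hwv.trans hv
  -- Jensen's inequality for powers, by repeated use of Chebyshev's.
  have h1 : ∀ q : ℕ, (∑ k, w k * l k) ^ q ≤ ∑ k, w k * l k ^ q := by
    intro q
    induction q with
    | zero => simp [hw1]
    | succ q ih =>
      have hnn : 0 ≤ ∑ k, w k * l k := Finset.sum_nonneg fun k _ => mul_nonneg (hw k) (hl k)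
      have hm : Monovary (fun k => l k ^ q) l := fun a b hab => pow_le_pow_left₀ (hl a) hab.le q
      calc _ ≤ (∑ k, w k * l k ^ q) * ∑ k, w k * l k := by
            rw [pow_succ]; exact mul_le_mul_of_nonneg_right ih hnn
        _ ≤ _ := sum_weight_mul_sum_weight_le hw hw1.le (fun k => pow_nonneg (hl k) q) hl hm
        _ = _ := by simp only [pow_succ]
  have hwk : ∀ k, w k ≤ 1 := fun k =>
    (Finset.single_le_sum (fun i _ => hw i) (Finset.mem_univ k)).trans hw1.le
  have hv1 : v ⬝ᵥ A *ᵥ v = ∑ k, w k * l k := by simpa using hquad 1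
  have h2 : (v ⬝ᵥ A *ᵥ v) ^ Q ≤ (A ^ Q).trace := by
    rw [hv1, htr]
    exact (h1 Q).trans (Finset.sum_le_sum fun k _ =>
      mul_le_of_le_one_left (pow_nonneg (hl k) Q) (hwk k))
  have h3 : (Q.factorial : ℝ)⁻¹ * (A ^ Q).trace ≤ (Matrix.truncExp Q A).trace := by
    rw [trace_truncExp]
    refine Finset.single_le_sum (f := fun q : ℕ => (q.factorial : ℝ)⁻¹ * (A ^ q).trace)
      (fun q _ => mul_nonneg (by positivity) ?_) (Finset.self_mem_range_succ Q)
    rw [htr]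
    exact Finset.sum_nonneg fun k _ => pow_nonneg (hl k) q
  have hf : (0 : ℝ) < Q.factorial := by positivity
  rw [inv_mul_le_iff₀ hf] at h3
  exact h2.trans h3

end RankOne

/-! ### Tail bounds for sums of independent rank-one matrices -/

theorem Matrix.l2_opNorm_le_of_dotProduct_le {ι κ : Type*} [Fintype ι] [DecidableEq ι] [Fintype κ]
    [DecidableEq κ] (H : Matrix ι κ ℝ) {S : ℝ} (hS : 0 ≤ S)
    (h : ∀ y : ι → ℝ, y ⬝ᵥ y = 1 → y ⬝ᵥ (H * H.transpose).mulVec y ≤ S ^ 2) : ‖H‖ ≤ S := by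
  rw [← Matrix.l2_opNorm_conjTranspose, Matrix.l2_opNorm_def]
  refine ContinuousLinearMap.opNorm_le_of_unit_norm hS fun y hy => ?_
  refine le_of_sq_le_sq ?_ hS
  have := h y ?_
  · refine le_trans (le_of_eq ?_) this
    rw [EuclideanSpace.real_norm_sq_eq, ← Matrix.mulVec_mulVec, Matrix.dotProduct_mulVec,
      ← Matrix.mulVec_transpose]
    simp [dotProduct, sq, Matrix.conjTranspose_eq_transpose_of_trivial]
  · have := EuclideanSpace.real_norm_sq_eq y
    rw [hy] at this
    simp only [dotProduct, ← sq]
    linarith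

section RandomSum

open scoped Matrix

variable {ι E : Type*} [Fintype ι] [DecidableEq ι]

/-- The sum of the rank-one matrices `v vᵀ` over the vectors `v` attached to a family of points. -/
noncomputable def sumRankOne (v : E → ι → ℝ) {m : ℕ} (p : Fin m → E) : Matrix ι ι ℝ :=
  ∑ i, Matrix.vecMulVec (v (p i)) (v (p i))

omit [DecidableEq ι] in
theorem posSemidef_sumRankOne (v : E → ι → ℝ) {m : ℕ} (p : Fin m → E) :
    (sumRankOne v p).PosSemidef := by
  refine Matrix.posSemidef_sum _ fun i _ => ?_
  simpa using Matrix.posSemidef_vecMulVec_self_star (v (p i))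

theorem measurable_trace_truncExp_sumRankOne [MeasurableSpace E] {v : E → ι → ℝ}
    (hv : Measurable v) (Q m : ℕ) :
    Measurable fun p : Fin m → E => (Matrix.truncExp Q (sumRankOne v p)).trace := by
  have hc : Continuous fun u : Fin m → ι → ℝ =>
      (Matrix.truncExp Q (∑ i, Matrix.vecMulVec (u i) (u i))).trace := by
    simp only [Matrix.trace_truncExp]
    refine continuous_finsetSum _ fun q _ => continuous_const.mul ?_
    refine Continuous.matrix_trace (Continuous.pow ?_ q)
    refine continuous_finsetSum _ fun i _ => ?_
    exact Continuous.matrix_vecMulVec (continuous_apply i) (continuous_apply i)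
  exact hc.measurable.comp
    (measurable_pi_lambda _ fun i => hv.comp (measurable_pi_apply i))

/-- Induction on the number of points: with the earlier ones fixed, averaging the rank-one estimate
over the new one multiplies the trace by at most `1 + 2ε`. With no points only the term of degree
`0` survives, the trace of the identity. -/
theorem lintegral_trace_truncExp_le [MeasurableSpace E] (μ : Measure E) [IsProbabilityMeasure μ]
    {v : E → ι → ℝ} (hv : ∀ x, v x ⬝ᵥ v x ≤ 1) {ε : ℝ} (hε : 0 ≤ ε)
    (hμ : ∀ B : Matrix ι ι ℝ, B.PosSemidef →
      ∫⁻ x, ENNReal.ofReal (v x ⬝ᵥ B *ᵥ v x) ∂μ ≤ ENNReal.ofReal (ε * B.trace)) (Q m : ℕ) :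
    ∫⁻ p, ENNReal.ofReal (Matrix.truncExp Q (sumRankOne v p)).trace
        ∂(Measure.pi fun _ : Fin m => μ) ≤
      ENNReal.ofReal ((1 + 2 * ε) ^ m * Fintype.card ι) := by
  induction m with
  | zero =>
    have : (Matrix.truncExp Q (0 : Matrix ι ι ℝ)).trace = Fintype.card ι := by
      rw [Matrix.trace_truncExp, Finset.sum_eq_single 0]
      · simp
      · intro q _ hq; simp [zero_pow hq]
      · simp
    simp [sumRankOne, this]
  | succ m ih =>
    have hstep : ∀ p : Fin m → E,
        ∫⁻ x, ENNReal.ofReal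
          (Matrix.truncExp Q (sumRankOne v p + Matrix.vecMulVec (v x) (v x))).trace ∂μ ≤
        ENNReal.ofReal (1 + 2 * ε) *
          ENNReal.ofReal (Matrix.truncExp Q (sumRankOne v p)).trace := by
      intro p
      have hA := posSemidef_sumRankOne v p
      have hB := hA.truncExp Q
      calc _ ≤ ∫⁻ x, (ENNReal.ofReal (Matrix.truncExp Q (sumRankOne v p)).trace +
            ENNReal.ofReal 2 *
              ENNReal.ofReal (v x ⬝ᵥ (Matrix.truncExp Q (sumRankOne v p)) *ᵥ v x)) ∂μ := by
            refine lintegral_mono fun x => ?_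
            have hq : 0 ≤ v x ⬝ᵥ (Matrix.truncExp Q (sumRankOne v p)) *ᵥ v x := by
              simpa using hB.dotProduct_mulVec_nonneg (v x)
            rw [← ENNReal.ofReal_mul zero_le_two,
              ← ENNReal.ofReal_add hB.trace_nonneg (by positivity)]
            exact ENNReal.ofReal_le_ofReal (hA.trace_truncExp_add_vecMulVec_le Q (hv x))
        _ = ENNReal.ofReal (Matrix.truncExp Q (sumRankOne v p)).trace + ENNReal.ofReal 2 *
              ∫⁻ x, ENNReal.ofReal (v x ⬝ᵥ (Matrix.truncExp Q (sumRankOne v p)) *ᵥ v x) ∂μ := by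
            rw [lintegral_add_left measurable_const, lintegral_const, measure_univ, mul_one,
              lintegral_const_mul' _ _ ENNReal.ofReal_ne_top]
        _ ≤ ENNReal.ofReal (Matrix.truncExp Q (sumRankOne v p)).trace + ENNReal.ofReal 2 *
              ENNReal.ofReal (ε * (Matrix.truncExp Q (sumRankOne v p)).trace) := by
            gcongr
            exact hμ _ hB
        _ = _ := by
            have := hB.trace_nonneg
            rw [← ENNReal.ofReal_mul zero_le_two, ← ENNReal.ofReal_add this (by positivity),
              ← ENNReal.ofReal_mul (by positivity)]
            congr 1
            ring
    calc _ = ∫⁻ z : E × (Fin m → E), ENNReal.ofReal (Matrix.truncExp Q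
            (sumRankOne v z.2 + Matrix.vecMulVec (v z.1) (v z.1))).trace
            ∂(μ.prod (Measure.pi fun _ : Fin m => μ)) := by
          rw [← ((measurePreserving_piFinSuccAbove (fun _ : Fin (m + 1) => μ)
            0).symm).lintegral_comp_emb (MeasurableEquiv.measurableEmbedding _)]
          refine lintegral_congr fun z => ?_
          simp [sumRankOne, Fin.sum_univ_succ, MeasurableEquiv.piFinSuccAbove_symm_apply,
            Fin.insertNthEquiv, add_comm]
      -- Swapped so that the new point is integrated first. The inequality half of Tonelli's
      -- theorem, used next, needs no measurability.
      _ = ∫⁻ z : (Fin m → E) × E, ENNReal.ofReal (Matrix.truncExp Q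
            (sumRankOne v z.1 + Matrix.vecMulVec (v z.2) (v z.2))).trace
            ∂((Measure.pi fun _ : Fin m => μ).prod μ) := by
          rw [← lintegral_prod_swap]
          rfl
      _ ≤ ∫⁻ p, ∫⁻ x, ENNReal.ofReal (Matrix.truncExp Q
            (sumRankOne v p + Matrix.vecMulVec (v x) (v x))).trace ∂μ
            ∂(Measure.pi fun _ : Fin m => μ) := lintegral_prod_le _
      _ ≤ ∫⁻ p, ENNReal.ofReal (1 + 2 * ε) *
          ENNReal.ofReal (Matrix.truncExp Q (sumRankOne v p)).trace
            ∂(Measure.pi fun _ : Fin m => μ) := lintegral_mono hstep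
      _ ≤ ENNReal.ofReal (1 + 2 * ε) * ENNReal.ofReal ((1 + 2 * ε) ^ m * Fintype.card ι) := by
          rw [lintegral_const_mul' _ _ ENNReal.ofReal_ne_top]
          gcongr
      _ = _ := by
          rw [← ENNReal.ofReal_mul (by positivity), pow_succ']
          congr 1
          ring

/-- A tail bound of matrix Chernoff type for a sum of independent rank-one matrices. -/
theorem measure_exists_lt_dotProduct_sumRankOne_le [MeasurableSpace E] (μ : Measure E)
    [IsProbabilityMeasure μ] {v : E → ι → ℝ} (hvm : Measurable v) (hv : ∀ x, v x ⬝ᵥ v x ≤ 1)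
    {ε : ℝ} (hε : 0 ≤ ε)
    (hμ : ∀ B : Matrix ι ι ℝ, B.PosSemidef →
      ∫⁻ x, ENNReal.ofReal (v x ⬝ᵥ B *ᵥ v x) ∂μ ≤ ENNReal.ofReal (ε * B.trace))
    (Q m : ℕ) {s : ℝ} (hs : 0 < s) :
    (Measure.pi fun _ : Fin m => μ).real
        {p | ∃ y : ι → ℝ, y ⬝ᵥ y = 1 ∧ s < y ⬝ᵥ (sumRankOne v p) *ᵥ y} ≤
      Q.factorial / s ^ Q * ((1 + 2 * ε) ^ m * Fintype.card ι) := by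
  have hf : (0 : ℝ) < Q.factorial := by positivity
  have hmeas := (measurable_trace_truncExp_sumRankOne hvm Q m).ennreal_ofReal
  have hsub : {p : Fin m → E | ∃ y : ι → ℝ, y ⬝ᵥ y = 1 ∧ s < y ⬝ᵥ (sumRankOne v p) *ᵥ y} ⊆
      {p | ENNReal.ofReal (s ^ Q / Q.factorial) ≤
        ENNReal.ofReal (Matrix.truncExp Q (sumRankOne v p)).trace} := by
    rintro p ⟨y, hy, hsy⟩
    refine ENNReal.ofReal_le_ofReal ?_
    rw [div_le_iff₀' hf]
    exact (pow_le_pow_left₀ hs.le hsy.le Q).trans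
      ((posSemidef_sumRankOne v p).pow_dotProduct_le_trace_truncExp hy)
  have hmarkov := meas_ge_le_lintegral_div (μ := Measure.pi fun _ : Fin m => μ)
    hmeas.aemeasurable (ε := ENNReal.ofReal (s ^ Q / Q.factorial))
    (by simpa using by positivity) ENNReal.ofReal_ne_top
  have hle := (measure_mono hsub).trans (hmarkov.trans
    (ENNReal.div_le_div_right (lintegral_trace_truncExp_le μ hv hε hμ Q m) _))
  rw [← ENNReal.ofReal_div_of_pos (by positivity)] at hle
  refine (ENNReal.toReal_mono ENNReal.ofReal_ne_top hle).trans ?_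
  rw [ENNReal.toReal_ofReal (by positivity)]
  apply le_of_eq
  field_simp

end RandomSum

/-! ### Orthonormality of the Hermite polynomials -/

theorem integrable_eval_gaussianReal (p : Polynomial ℝ) :
    Integrable (fun x => p.eval x) (gaussianReal 0 1) := by
  induction p using Polynomial.induction_on' with
  | add p q hp hq =>
    simp only [Polynomial.eval_add]
    exact hp.add hq
  | monomial n a =>
    simp only [Polynomial.eval_monomial]
    refine Integrable.const_mul ?_ a
    refine integrable_pow_of_mem_interior_integrableExpSet (X := fun x : ℝ => x) ?_ n
    simp [integrableExpSet_fun_id_gaussianReal]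

theorem integrable_gaussianPDFReal_mul_eval (p : Polynomial ℝ) :
    Integrable fun x => gaussianPDFReal 0 1 x * p.eval x := by
  have h := integrable_eval_gaussianReal p
  rw [gaussianReal_of_var_ne_zero _ one_ne_zero, integrable_withDensity_iff_integrable_smul'
    (measurable_gaussianPDF 0 1) (Filter.Eventually.of_forall fun _ => gaussianPDF_lt_top)] at h
  simpa [toReal_gaussianPDF] using h

theorem hasDerivAt_gaussianPDFReal_zero_one (x : ℝ) :
    HasDerivAt (gaussianPDFReal 0 1) (-x * gaussianPDFReal 0 1 x) x := by
  have h : HasDerivAt (fun y : ℝ => -(y - 0) ^ 2 / (2 * ((1 : NNReal) : ℝ))) (-x) x := by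
    have := (((hasDerivAt_id x).sub_const 0).pow 2).neg.div_const (2 * ((1 : NNReal) : ℝ))
    refine this.congr_deriv ?_
    simp
    ring
  have := (h.exp).const_mul (√(2 * Real.pi * ((1 : NNReal) : ℝ)))⁻¹
  rw [gaussianPDFReal_def]
  refine this.congr_deriv ?_
  ring

/-- Gaussian integration by parts for polynomials. -/
theorem integral_X_mul_eval_gaussianReal (p : Polynomial ℝ) :
    ∫ x, x * p.eval x ∂(gaussianReal 0 1) = ∫ x, p.derivative.eval x ∂(gaussianReal 0 1) := by
  have hint : Integrable fun x => gaussianPDFReal 0 1 x * p.derivative.eval x -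
      gaussianPDFReal 0 1 x * (Polynomial.X * p).eval x :=
    (integrable_gaussianPDFReal_mul_eval _).sub (integrable_gaussianPDFReal_mul_eval _)
  have h := integral_eq_zero_of_hasDerivAt_of_integrable
    (f := fun x => gaussianPDFReal 0 1 x * p.eval x) (fun x => ?_) hint
    (integrable_gaussianPDFReal_mul_eval p)
  · rw [integral_sub (integrable_gaussianPDFReal_mul_eval _)
      (integrable_gaussianPDFReal_mul_eval _), sub_eq_zero] at h
    rw [integral_gaussianReal_eq_integral_smul one_ne_zero,
      integral_gaussianReal_eq_integral_smul one_ne_zero]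
    simpa using h.symm
  · refine ((hasDerivAt_gaussianPDFReal_zero_one x).mul (p.hasDerivAt x)).congr_deriv ?_
    simp
    ring

/-- The Hermite polynomials with real coefficients. -/
noncomputable def realHermite (n : ℕ) : Polynomial ℝ :=
  (Polynomial.hermite n).map (Int.castRingHom ℝ)

theorem normHermite_eq (n : ℕ) (x : ℝ) :
    normHermite n x = (realHermite n).eval x / √(n.factorial : ℝ) := by
  rw [normHermite, realHermite, Polynomial.eval_map, Polynomial.aeval_def]
  rfl

theorem natDegree_realHermite (n : ℕ) : (realHermite n).natDegree = n := by
  rw [realHermite, (Polynomial.hermite_monic n).natDegree_map, Polynomial.natDegree_hermite]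

/-- By Gaussian integration by parts, `q ↦ X q - q'`, which produces `He_{n+1}` from `He_n`, is
adjoint to differentiation. -/
theorem integral_hermite_mul_eval_gaussianReal (n : ℕ) : ∀ p : Polynomial ℝ,
    ∫ x, (realHermite n).eval x * p.eval x ∂(gaussianReal 0 1) =
      ∫ x, (Polynomial.derivative^[n] p).eval x ∂(gaussianReal 0 1) := by
  induction n with
  | zero => intro p; simp [realHermite]
  | succ n ih =>
    intro p
    have hrec : realHermite (n + 1) =
        Polynomial.X * realHermite n - Polynomial.derivative (realHermite n) := by
      simp [realHermite, Polynomial.hermite_succ, Polynomial.derivative_map]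
    have h1 := integral_X_mul_eval_gaussianReal (realHermite n * p)
    have h2 : ∀ x, (realHermite (n + 1)).eval x * p.eval x = (Polynomial.X *
        (realHermite n * p)).eval x - (Polynomial.derivative (realHermite n) * p).eval x := by
      intro x; rw [hrec]; simp; ring
    have h3 : ∀ x, (Polynomial.derivative (realHermite n * p)).eval x =
        (Polynomial.derivative (realHermite n) * p).eval x +
          (realHermite n * Polynomial.derivative p).eval x := by
      intro x; simp
    simp only [h2]
    rw [integral_sub (integrable_eval_gaussianReal _) (integrable_eval_gaussianReal _)]
    have h4 : ∀ x, (Polynomial.X * (realHermite n * p)).eval x =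
        x * (realHermite n * p).eval x := by
      intro x; simp
    simp only [h4]
    rw [h1]
    simp only [h3]
    rw [integral_add (integrable_eval_gaussianReal _) (integrable_eval_gaussianReal _),
      add_sub_cancel_left, Function.iterate_succ_apply, ← ih]
    simp

theorem integrable_normHermite_mul (i j : ℕ) :
    Integrable (fun x => normHermite i x * normHermite j x) (gaussianReal 0 1) := by
  have := (integrable_eval_gaussianReal (realHermite i * realHermite j)).div_const
    (√(i.factorial : ℝ) * √(j.factorial : ℝ))
  refine this.congr (Filter.Eventually.of_forall fun x => ?_)
  simp only [normHermite_eq, Polynomial.eval_mul]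
  ring

/-- The normalized Hermite polynomials are orthonormal in `L²(N(0,1))`. -/
theorem integral_normHermite_mul (i j : ℕ) :
    ∫ x, normHermite i x * normHermite j x ∂(gaussianReal 0 1) = if i = j then 1 else 0 := by
  have hlt : ∀ i j : ℕ, i < j →
      ∫ x, normHermite j x * normHermite i x ∂(gaussianReal 0 1) = 0 := by
    intro i j hij
    have h := integral_hermite_mul_eval_gaussianReal j (realHermite i)
    rw [Polynomial.iterate_derivative_eq_zero (by rwa [natDegree_realHermite])] at h
    simp only [normHermite_eq, div_mul_div_comm]
    rw [integral_div, h]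
    simp
  split_ifs with hij
  · subst hij
    have h := integral_hermite_mul_eval_gaussianReal i (realHermite i)
    have hder : Polynomial.derivative^[i] (realHermite i) = Polynomial.C (i.factorial : ℝ) := by
      have hdeg : (Polynomial.derivative^[i] (realHermite i)).natDegree ≤ 0 :=
        (Polynomial.natDegree_iterate_derivative _ _).trans (by rw [natDegree_realHermite]; simp)
      rw [Polynomial.eq_C_of_natDegree_le_zero hdeg, Polynomial.coeff_iterate_derivative]
      simp [realHermite, Nat.descFactorial_self]
    simp only [hder, Polynomial.eval_C, integral_const, probReal_univ, one_smul] at h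
    simp only [normHermite_eq, div_mul_div_comm]
    rw [integral_div, h, Real.mul_self_sqrt (by positivity), div_self (by positivity)]
  · rcases lt_or_gt_of_ne hij with h | h
    · simp only [mul_comm (normHermite i _), hlt i j h]
    · exact hlt j i h

theorem continuous_normHermite (j : ℕ) : Continuous (normHermite j) := by
  have : normHermite j = fun x => (realHermite j).eval x / √(j.factorial : ℝ) :=
    funext (normHermite_eq j)
  rw [this]
  exact (Polynomial.continuous _).div_const _

theorem continuous_multiHermite {n : ℕ} (I : Multiset (Fin n)) :
    Continuous (multiHermite I) := by
  unfold multiHermite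
  refine continuous_finsetProd _ fun k _ => (continuous_normHermite _).comp ?_
  fun_prop

theorem integral_stdGaussian_euclideanSpace {n : ℕ} {f : EuclideanSpace ℝ (Fin n) → ℝ} :
    ∫ x, f x ∂(stdGaussian (EuclideanSpace ℝ (Fin n))) =
      ∫ x, f (WithLp.toLp 2 x) ∂(Measure.pi fun _ : Fin n => gaussianReal 0 1) := by
  rw [← map_pi_eq_stdGaussian]
  exact integral_map_equiv (MeasurableEquiv.toLp 2 (Fin n → ℝ)) f

theorem integrable_multiHermite_mul {n : ℕ} (I J : Multiset (Fin n)) :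
    Integrable (fun x => multiHermite I x * multiHermite J x)
      (stdGaussian (EuclideanSpace ℝ (Fin n))) := by
  rw [← map_pi_eq_stdGaussian]
  refine (integrable_map_equiv (MeasurableEquiv.toLp 2 (Fin n → ℝ)) _).mpr ?_
  have := Integrable.fintype_prod (μ := fun _ : Fin n => gaussianReal 0 1)
    (f := fun k x => normHermite (I.count k) x * normHermite (J.count k) x)
    fun k => integrable_normHermite_mul _ _
  refine this.congr (Filter.Eventually.of_forall fun x => ?_)
  simp [multiHermite, Finset.prod_mul_distrib]

/-- The multivariate Hermite polynomials are orthonormal for the standard Gaussian measure. -/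
theorem integral_multiHermite_mul {n : ℕ} (I J : Multiset (Fin n)) :
    ∫ x, multiHermite I x * multiHermite J x ∂(stdGaussian (EuclideanSpace ℝ (Fin n))) =
      if I = J then 1 else 0 := by
  rw [integral_stdGaussian_euclideanSpace]
  simp only [multiHermite, ← Finset.prod_mul_distrib]
  rw [integral_fintype_prod_eq_prod
    (f := fun k x => normHermite (I.count k) x * normHermite (J.count k) x)]
  simp only [integral_normHermite_mul]
  split_ifs with h
  · simp [h]
  · obtain ⟨k, hk⟩ : ∃ k, I.count k ≠ J.count k := by
      by_contra! hcon
      exact h (Multiset.ext.mpr hcon)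
    exact Finset.prod_eq_zero (Finset.mem_univ k) (if_neg hk)

/-! ### Counting indices, bounds on a box, and Gaussian tails -/

theorem card_multiIndex_le (n d : ℕ) : Fintype.card (MultiIndex n d) ≤ (n + 1) ^ d := by
  -- A multiset is listed in a chosen order and padded with `none` to length `d`, giving `n + 1`
  -- choices per slot.
  have hinj : Function.Injective
      (fun (I : MultiIndex n d) (i : Fin d) => (I.1.toList[(i : ℕ)]? : Option (Fin n))) := by
    intro I J h
    apply Subtype.ext
    rw [← Multiset.coe_toList I.1, ← Multiset.coe_toList J.1]
    congr 1
    refine List.ext_getElem? fun i => ?_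
    rcases lt_or_ge i d with hi | hi
    · exact congrFun h ⟨i, hi⟩
    · rw [List.getElem?_eq_none, List.getElem?_eq_none]
      · simpa using J.2.2.trans hi
      · simpa using I.2.2.trans hi
  simpa using Fintype.card_le_of_injective _ hinj

/-- The exponent `j`, with no further constant in front, matters: in a product over all `n`
coordinates those of multiplicity `0` contribute exactly `1`, so the bound for `h_I` does not depend
on `n`. -/
theorem exists_abs_normHermite_le (d : ℕ) : ∃ c : ℝ, 1 ≤ c ∧ ∀ j ≤ d, ∀ T x : ℝ, 1 ≤ T →
    |x| ≤ T → |normHermite j x| ≤ (c * T) ^ j := by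
  set a : ℕ → ℝ := fun j => ∑ i ∈ Finset.range (j + 1), |(realHermite j).coeff i| with ha
  have ha0 : ∀ j, 0 ≤ a j := fun j => Finset.sum_nonneg fun i _ => abs_nonneg _
  refine ⟨1 + ∑ j ∈ Finset.range (d + 1), a j,
    le_add_of_nonneg_right (Finset.sum_nonneg fun j _ => ha0 j), fun j hj T x hT hx => ?_⟩
  set c := 1 + ∑ j ∈ Finset.range (d + 1), a j with hc
  have hac : a j ≤ c := by
    have := Finset.single_le_sum (f := a) (fun i _ => ha0 i)
      (Finset.mem_range.mpr (Nat.lt_succ_of_le hj))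
    linarith
  have hc1 : 1 ≤ c := le_add_of_nonneg_right (Finset.sum_nonneg fun j _ => ha0 j)
  rcases Nat.eq_zero_or_pos j with rfl | hj0
  · simp [normHermite]
  have h1 : |(realHermite j).eval x| ≤ a j * T ^ j := by
    rw [Polynomial.eval_eq_sum_range, natDegree_realHermite, ha, Finset.sum_mul]
    refine (Finset.abs_sum_le_sum_abs _ _).trans (Finset.sum_le_sum fun i hi => ?_)
    rw [abs_mul, abs_pow]
    refine mul_le_mul_of_nonneg_left ?_ (abs_nonneg _)
    exact (pow_le_pow_left₀ (abs_nonneg x) hx i).trans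
      (pow_le_pow_right₀ hT (Nat.lt_succ_iff.mp (Finset.mem_range.mp hi)))
  have h2 : 1 ≤ √(j.factorial : ℝ) := by
    rw [Real.one_le_sqrt]
    exact_mod_cast j.factorial_pos
  rw [normHermite_eq, abs_div, abs_of_nonneg (Real.sqrt_nonneg _), mul_pow]
  calc _ ≤ |(realHermite j).eval x| := div_le_self (abs_nonneg _) h2
    _ ≤ a j * T ^ j := h1
    _ ≤ c ^ j * T ^ j := by
        refine mul_le_mul_of_nonneg_right (hac.trans ?_) (by positivity)
        exact le_self_pow₀ hc1 hj0.ne'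

theorem abs_multiHermite_le {d n : ℕ} {c T : ℝ} (hc : 1 ≤ c) (hT : 1 ≤ T)
    (h : ∀ j ≤ d, ∀ T x : ℝ, 1 ≤ T → |x| ≤ T → |normHermite j x| ≤ (c * T) ^ j)
    (I : MultiIndex n d) {x : EuclideanSpace ℝ (Fin n)} (hx : ∀ k, |x k| ≤ T) :
    |multiHermite I.1 x| ≤ (c * T) ^ d := by
  have hcT : 1 ≤ c * T := one_le_mul_of_one_le_of_one_le hc hT
  rw [multiHermite, Finset.abs_prod]
  calc _ ≤ ∏ k : Fin n, (c * T) ^ I.1.count k :=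
        Finset.prod_le_prod (fun k _ => abs_nonneg _) fun k _ =>
          h _ ((Multiset.count_le_card k I.1).trans I.2.2) T _ hT (hx k)
    _ = (c * T) ^ I.1.card := by
        rw [Finset.prod_pow_eq_pow_sum, Multiset.sum_count_eq_card fun a _ => Finset.mem_univ a]
    _ ≤ _ := pow_le_pow_right₀ hcT I.2.2

/-- Chernoff's bound with `t` left free: for fixed `t` and `T = log n` it is a constant times `n ^
(-t)`. -/
theorem gaussianReal_real_lt_abs_le {t : ℝ} (ht : 0 ≤ t) (T : ℝ) :
    (gaussianReal 0 1).real {x | T < |x|} ≤ 2 * Real.exp (t ^ 2 / 2 - t * T) := by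
  have h1 := measure_ge_le_exp_mul_mgf (μ := gaussianReal 0 1) (X := id) T ht
    (integrable_exp_mul_gaussianReal t)
  have h2 := measure_le_le_exp_mul_mgf (μ := gaussianReal 0 1) (X := id) (-T)
    (neg_nonpos.mpr ht) (integrable_exp_mul_gaussianReal (-t))
  rw [mgf_id_gaussianReal] at h1 h2
  simp only [← Real.exp_add, id] at h1 h2
  have e1 : -t * T + (0 * t + ((1 : NNReal) : ℝ) * t ^ 2 / 2) = t ^ 2 / 2 - t * T := by
    simp; ring
  have e2 : - -t * -T + (0 * -t + ((1 : NNReal) : ℝ) * (-t) ^ 2 / 2) = t ^ 2 / 2 - t * T := by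
    simp; ring
  rw [e1] at h1
  rw [e2] at h2
  have hsub : {x : ℝ | T < |x|} ⊆ {x | T ≤ x} ∪ {x | x ≤ -T} := by
    intro x hx
    rcases lt_abs.mp (show T < |x| from hx) with h | h
    · exact Or.inl h.le
    · exact Or.inr (show x ≤ -T by linarith)
  calc _ ≤ _ := measureReal_mono hsub
    _ ≤ _ := measureReal_union_le _ _
    _ ≤ _ := by linarith

instance isProbabilityMeasure_gaussianPoints (n m : ℕ) :
    IsProbabilityMeasure (gaussianPoints n m) := by
  unfold gaussianPoints
  infer_instance

theorem measurePreserving_coord_gaussianPoints {n m : ℕ} (i : Fin m) (k : Fin n) :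
    MeasurePreserving (fun p : Fin m → EuclideanSpace ℝ (Fin n) => p i k)
      (gaussianPoints n m) (gaussianReal 0 1) := by
  have h1 : MeasurePreserving (fun x : EuclideanSpace ℝ (Fin n) => x k)
      (stdGaussian (EuclideanSpace ℝ (Fin n))) (gaussianReal 0 1) := by
    refine ⟨by fun_prop, ?_⟩
    rw [← map_pi_eq_stdGaussian, Measure.map_map (by fun_prop) (by fun_prop)]
    exact (measurePreserving_eval (fun _ : Fin n => gaussianReal 0 1) k).map_eq
  exact h1.comp (measurePreserving_eval
    (fun _ : Fin m => stdGaussian (EuclideanSpace ℝ (Fin n))) i)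

theorem gaussianPoints_real_exists_lt_abs_le (n m : ℕ) {t : ℝ} (ht : 0 ≤ t) (T : ℝ) :
    (gaussianPoints n m).real {p | ∃ i k, T < |p i k|} ≤
      m * (n * (2 * Real.exp (t ^ 2 / 2 - t * T))) := by
  have hset : {p : Fin m → EuclideanSpace ℝ (Fin n) | ∃ i k, T < |p i k|} =
      ⋃ i, ⋃ k, {p | T < |p i k|} := by ext p; simp
  rw [hset]
  have hone : ∀ (i : Fin m) (k : Fin n),
      (gaussianPoints n m).real {p | T < |p i k|} ≤ 2 * Real.exp (t ^ 2 / 2 - t * T) := by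
    intro i k
    have hm : MeasurableSet {x : ℝ | T < |x|} := measurableSet_lt measurable_const (by fun_prop)
    have := (measurePreserving_coord_gaussianPoints i k).measureReal_preimage hm.nullMeasurableSet
    exact this.le.trans (gaussianReal_real_lt_abs_le ht T)
  calc _ ≤ ∑ i : Fin m, (gaussianPoints n m).real (⋃ k, {p | T < |p i k|}) :=
        measureReal_iUnion_fintype_le _
    _ ≤ ∑ i : Fin m, ∑ k : Fin n, (gaussianPoints n m).real {p | T < |p i k|} :=
        Finset.sum_le_sum fun i _ => measureReal_iUnion_fintype_le _
    _ ≤ ∑ i : Fin m, ∑ k : Fin n, 2 * Real.exp (t ^ 2 / 2 - t * T) :=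
        Finset.sum_le_sum fun i _ => Finset.sum_le_sum fun k _ => hone i k
    _ = _ := by simp

/-! ### Truncated Hermite features -/

/-- The Hermite features of degree between `1` and `d`, divided by `√L` and set to zero outside
the box of half-width `T`. -/
noncomputable def truncHermite (d : ℕ) {n : ℕ} (T L : ℝ) (x : EuclideanSpace ℝ (Fin n)) :
    MultiIndex n d → ℝ :=
  fun I => {x : EuclideanSpace ℝ (Fin n) | ∀ k, |x k| ≤ T}.indicator
    (fun x => (√L)⁻¹ * multiHermite I.1 x) x

theorem measurable_truncHermite (d n : ℕ) (T L : ℝ) :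
    Measurable (truncHermite d T L : EuclideanSpace ℝ (Fin n) → _) := by
  refine measurable_pi_lambda _ fun I => Measurable.indicator ?_ ?_
  · exact (measurable_const.mul (continuous_multiHermite I.1).measurable)
  · rw [Set.ofPred_forall]
    exact MeasurableSet.iInter fun k => measurableSet_le (by fun_prop) measurable_const

theorem truncHermite_dotProduct_self_le {d n : ℕ} {c T L : ℝ} (hc : 1 ≤ c) (hT : 1 ≤ T)
    (h : ∀ j ≤ d, ∀ T x : ℝ, 1 ≤ T → |x| ≤ T → |normHermite j x| ≤ (c * T) ^ j)
    (hL : ((n : ℝ) + 1) ^ d * (c * T) ^ (2 * d) ≤ L) (x : EuclideanSpace ℝ (Fin n)) :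
    truncHermite d T L x ⬝ᵥ truncHermite d T L x ≤ 1 := by
  have hcT : 0 < c * T := by positivity
  have hL0 : 0 < L := lt_of_lt_of_le (by positivity) hL
  by_cases hx : ∀ k, |x k| ≤ T
  · have hterm : ∀ I : MultiIndex n d, truncHermite d T L x I * truncHermite d T L x I ≤
        L⁻¹ * (c * T) ^ (2 * d) := by
      intro I
      have h1 : truncHermite d T L x I = (√L)⁻¹ * multiHermite I.1 x :=
        Set.indicator_of_mem (s := {x : EuclideanSpace ℝ (Fin n) | ∀ k, |x k| ≤ T}) hx _
      have h2 : multiHermite I.1 x ^ 2 ≤ (c * T) ^ (2 * d) := by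
        rw [mul_comm 2 d, pow_mul, ← sq_abs]
        exact pow_le_pow_left₀ (abs_nonneg _) (abs_multiHermite_le hc hT h I hx) 2
      rw [h1, ← sq, mul_pow, inv_pow, Real.sq_sqrt hL0.le]
      exact mul_le_mul_of_nonneg_left h2 (by positivity)
    calc _ ≤ ∑ _I : MultiIndex n d, L⁻¹ * (c * T) ^ (2 * d) :=
          Finset.sum_le_sum fun I _ => hterm I
      _ = (Fintype.card (MultiIndex n d) : ℝ) * (L⁻¹ * (c * T) ^ (2 * d)) := by simp
      _ ≤ ((n : ℝ) + 1) ^ d * (L⁻¹ * (c * T) ^ (2 * d)) := by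
          gcongr
          exact_mod_cast card_multiIndex_le n d
      _ = L⁻¹ * (((n : ℝ) + 1) ^ d * (c * T) ^ (2 * d)) := by ring
      _ ≤ L⁻¹ * L := by gcongr
      _ = 1 := inv_mul_cancel₀ hL0.ne'
  · have h0 : truncHermite d T L x = 0 := funext fun I =>
      Set.indicator_of_notMem (s := {x : EuclideanSpace ℝ (Fin n) | ∀ k, |x k| ≤ T}) hx _
    simp [h0]

-- By orthonormality the untruncated form has mean `tr B`; as `B ≥ 0`, setting the features to zero
-- off the box can only lower it.
open scoped Matrix in
theorem lintegral_truncHermite_dotProduct_le {d n : ℕ} (T : ℝ) {L : ℝ} (hL : 0 < L)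
    {B : Matrix (MultiIndex n d) (MultiIndex n d) ℝ} (hB : B.PosSemidef) :
    ∫⁻ x, ENNReal.ofReal (truncHermite d T L x ⬝ᵥ B *ᵥ truncHermite d T L x)
        ∂(stdGaussian (EuclideanSpace ℝ (Fin n))) ≤ ENNReal.ofReal (L⁻¹ * B.trace) := by
  set g : EuclideanSpace ℝ (Fin n) → MultiIndex n d → ℝ := fun x I => multiHermite I.1 x with hg
  have hnn : ∀ x, 0 ≤ g x ⬝ᵥ B *ᵥ g x := fun x => by
    simpa using hB.dotProduct_mulVec_nonneg (g x)
  have hexp : ∀ x, g x ⬝ᵥ B *ᵥ g x =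
      ∑ I, ∑ J, B I J * (multiHermite I.1 x * multiHermite J.1 x) := by
    intro x
    simp only [dotProduct, Matrix.mulVec, Finset.mul_sum, hg]
    exact Finset.sum_congr rfl fun I _ => Finset.sum_congr rfl fun J _ => by ring
  have hterm : ∀ I J : MultiIndex n d,
      Integrable (fun x => B I J * (multiHermite I.1 x * multiHermite J.1 x))
        (stdGaussian (EuclideanSpace ℝ (Fin n))) :=
    fun I J => (integrable_multiHermite_mul I.1 J.1).const_mul _
  have hint : Integrable (fun x => g x ⬝ᵥ B *ᵥ g x)
      (stdGaussian (EuclideanSpace ℝ (Fin n))) := by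
    simp only [hexp]
    exact integrable_finsetSum _ fun I _ => integrable_finsetSum _ fun J _ => hterm I J
  have hval : ∫ x, g x ⬝ᵥ B *ᵥ g x ∂(stdGaussian (EuclideanSpace ℝ (Fin n))) = B.trace := by
    simp only [hexp]
    rw [integral_finsetSum _ fun I _ => integrable_finsetSum _ fun J _ => hterm I J]
    refine Finset.sum_congr rfl fun I _ => ?_
    rw [integral_finsetSum _ fun J _ => hterm I J, Finset.sum_eq_single I]
    · rw [integral_const_mul, integral_multiHermite_mul]
      simp
    · intro J _ hJ
      rw [integral_const_mul, integral_multiHermite_mul, if_neg, mul_zero]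
      exact fun h => hJ (Subtype.ext h).symm
    · simp
  calc _ ≤ ∫⁻ x, ENNReal.ofReal (L⁻¹ * (g x ⬝ᵥ B *ᵥ g x))
        ∂(stdGaussian (EuclideanSpace ℝ (Fin n))) := by
        refine lintegral_mono fun x => ENNReal.ofReal_le_ofReal ?_
        by_cases hx : ∀ k, |x k| ≤ T
        · have h1 : truncHermite d T L x = (√L)⁻¹ • g x := funext fun I =>
            Set.indicator_of_mem (s := {x : EuclideanSpace ℝ (Fin n) | ∀ k, |x k| ≤ T}) hx _
          rw [h1, Matrix.mulVec_smul, dotProduct_smul, smul_dotProduct, smul_eq_mul, smul_eq_mul,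
            ← mul_assoc, ← mul_inv, Real.mul_self_sqrt hL.le]
        · have h0 : truncHermite d T L x = 0 := funext fun I =>
            Set.indicator_of_notMem (s := {x : EuclideanSpace ℝ (Fin n) | ∀ k, |x k| ≤ T}) hx _
          rw [h0, zero_dotProduct]
          exact mul_nonneg (by positivity) (hnn x)
    _ = ENNReal.ofReal (L⁻¹ * B.trace) := by
        rw [← ofReal_integral_eq_lintegral_ofReal (hint.const_mul _)
          (Filter.Eventually.of_forall fun x => mul_nonneg (by positivity) (hnn x)),
          integral_const_mul, hval]

theorem hermiteMatrix_mul_transpose {d n m : ℕ} {T L : ℝ} (hL : 0 < L)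
    {p : Fin m → EuclideanSpace ℝ (Fin n)} (hp : ∀ i k, |p i k| ≤ T) :
    hermiteMatrix d p * (hermiteMatrix d p).transpose =
      L • sumRankOne (truncHermite d T L) p := by
  ext I J
  have h1 : ∀ i (I : MultiIndex n d),
      truncHermite d T L (p i) I = (√L)⁻¹ * multiHermite I.1 (p i) := fun i I =>
    Set.indicator_of_mem (s := {x : EuclideanSpace ℝ (Fin n) | ∀ k, |x k| ≤ T}) (hp i) _
  simp only [Matrix.mul_apply, Matrix.transpose_apply, hermiteMatrix, Matrix.of_apply,
    Matrix.smul_apply, sumRankOne, Matrix.sum_apply, Matrix.vecMulVec_apply, h1, smul_eq_mul,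
    Finset.mul_sum]
  refine Finset.sum_congr rfl fun i _ => ?_
  have : L * ((√L)⁻¹ * (√L)⁻¹) = 1 := by
    rw [← mul_inv, Real.mul_self_sqrt hL.le, mul_inv_cancel₀ hL.ne']
  linear_combination (-(multiHermite I.1 (p i) * multiHermite J.1 (p i))) * this

/-! ### Union bound and choice of parameters -/

theorem norm_hermiteMatrix_tail {d n m : ℕ} {c T L S s t : ℝ} (hc : 1 ≤ c) (hT : 1 ≤ T)
    (h : ∀ j ≤ d, ∀ T x : ℝ, 1 ≤ T → |x| ≤ T → |normHermite j x| ≤ (c * T) ^ j)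
    (hL : ((n : ℝ) + 1) ^ d * (c * T) ^ (2 * d) ≤ L) (hs : 0 < s) (ht : 0 ≤ t) (hS : 0 ≤ S)
    (hSL : L * s ≤ S ^ 2) (Q : ℕ) :
    1 - (m * (n * (2 * Real.exp (t ^ 2 / 2 - t * T))) +
        Q.factorial / s ^ Q * ((1 + 2 * L⁻¹) ^ m * ((n : ℝ) + 1) ^ d)) ≤
      (gaussianPoints n m).real {p | ‖hermiteMatrix d p‖ ≤ S} := by
  have hL0 : 0 < L := lt_of_lt_of_le (by positivity) hL
  set bad₁ : Set (Fin m → EuclideanSpace ℝ (Fin n)) := {p | ∃ i k, T < |p i k|} with hb1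
  set bad₂ : Set (Fin m → EuclideanSpace ℝ (Fin n)) := {p | ∃ y : MultiIndex n d → ℝ,
    y ⬝ᵥ y = 1 ∧ s < y ⬝ᵥ (sumRankOne (truncHermite d T L) p).mulVec y} with hb2
  -- Covering the space and using subadditivity avoids proving these events measurable. If every
  -- point is in the box, truncation changes nothing.
  have hcover : (Set.univ : Set (Fin m → EuclideanSpace ℝ (Fin n))) ⊆
      {p | ‖hermiteMatrix d p‖ ≤ S} ∪ (bad₁ ∪ bad₂) := by
    intro p _
    by_contra hcon
    simp only [Set.mem_union, not_or] at hcon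
    obtain ⟨hn, h1, h2⟩ := hcon
    simp only [hb1, hb2, Set.mem_ofPred_eq, not_exists, not_and, not_lt] at h1 h2
    refine hn (Matrix.l2_opNorm_le_of_dotProduct_le _ hS fun y hy => ?_)
    rw [hermiteMatrix_mul_transpose hL0 h1, Matrix.smul_mulVec, dotProduct_smul, smul_eq_mul]
    exact (mul_le_mul_of_nonneg_left (h2 y hy) hL0.le).trans hSL
  have hB1 := gaussianPoints_real_exists_lt_abs_le n m ht T
  have hB2 : (gaussianPoints n m).real bad₂ ≤
      Q.factorial / s ^ Q * ((1 + 2 * L⁻¹) ^ m * ((n : ℝ) + 1) ^ d) := by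
    refine (measure_exists_lt_dotProduct_sumRankOne_le
      (stdGaussian (EuclideanSpace ℝ (Fin n))) (measurable_truncHermite d n T L)
      (truncHermite_dotProduct_self_le hc hT h hL) (inv_nonneg.mpr hL0.le)
      (fun B hB => lintegral_truncHermite_dotProduct_le T hL0 hB) Q m hs).trans ?_
    gcongr
    exact_mod_cast card_multiIndex_le n d
  have hone : (1 : ℝ) ≤ (gaussianPoints n m).real {p | ‖hermiteMatrix d p‖ ≤ S} +
      ((gaussianPoints n m).real bad₁ + (gaussianPoints n m).real bad₂) := by
    calc (1 : ℝ) = (gaussianPoints n m).real Set.univ := probReal_univ.symm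
      _ ≤ _ := measureReal_mono hcover
      _ ≤ _ := measureReal_union_le _ _
      _ ≤ _ := by gcongr; exact measureReal_union_le _ _
  linarith

/-- With `Q = ⌈T⌉ ≤ 2T`, the bound `Q! ≤ Q^Q` gives a ratio of at most `(2/T)^Q`, and `2/T ≤
e^(-t)`. -/
theorem factorial_ceil_div_le {T t : ℝ} (ht : 0 ≤ t) (hT : 2 * Real.exp t ≤ T) :
    ((⌈T⌉₊).factorial : ℝ) / (T ^ 2) ^ ⌈T⌉₊ ≤ Real.exp (-(t * T)) := by
  have h1 : 1 ≤ Real.exp t := Real.one_le_exp ht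
  have hT0 : 0 < T := by linarith
  have hQ : (⌈T⌉₊ : ℝ) ≤ 2 * T := by
    have := (Nat.ceil_lt_add_one hT0.le).le
    linarith
  have hfac : ((⌈T⌉₊).factorial : ℝ) ≤ (2 * T) ^ ⌈T⌉₊ := by
    calc ((⌈T⌉₊).factorial : ℝ) ≤ (⌈T⌉₊ : ℝ) ^ ⌈T⌉₊ := by exact_mod_cast Nat.factorial_le_pow _
      _ ≤ _ := pow_le_pow_left₀ (by positivity) hQ _
  calc _ ≤ (2 * T) ^ ⌈T⌉₊ / (T ^ 2) ^ ⌈T⌉₊ := by gcongr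
    _ = (2 / T) ^ ⌈T⌉₊ := by
        rw [← div_pow]
        congr 1
        field_simp
    _ ≤ (Real.exp (-t)) ^ ⌈T⌉₊ := by
        refine pow_le_pow_left₀ (by positivity) ?_ _
        rw [div_le_iff₀ hT0, Real.exp_neg, inv_mul_eq_div, le_div_iff₀ (by positivity)]
        exact hT
    _ = Real.exp (-(t * ⌈T⌉₊)) := by rw [← Real.exp_nat_mul]; congr 1; ring
    _ ≤ _ := by
        refine Real.exp_le_exp.mpr (neg_le_neg ?_)
        exact mul_le_mul_of_nonneg_left (Nat.le_ceil T) ht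

/-- `‖hermiteMatrix d p‖` is the spectral norm (the `ℓ² → ℓ²` operator norm). -/
theorem mainTheorem5 (d : ℕ) :
    ∃ (C : ℝ) (k : ℕ), 0 < C ∧
      ∀ δ : ℝ, 0 < δ → ∀ β : ℝ, 0 < β →
        ∃ N : ℕ, ∀ n : ℕ, N ≤ n → ∀ m : ℕ, (m : ℝ) ≤ (n : ℝ) ^ ((d : ℝ) - δ) →
          1 - (n : ℝ) ^ (-β) ≤
            (gaussianPoints n m).real
              {p | ‖hermiteMatrix d p‖ ≤
                C * Real.log (n : ℝ) ^ k * (n : ℝ) ^ ((d : ℝ) / 2)} := by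
  obtain ⟨c, hc, hH⟩ := exists_abs_normHermite_le d
  -- In `‖H‖² ≤ L T²` there are `2d` logarithms from `L` and two from `s = T²`; half of them gives
  -- `d + 1`.
  refine ⟨2 ^ d * c ^ d, d + 1, by positivity, fun δ hδ β hβ => ?_⟩
  -- Beyond `β`, the exponent pays `d` for the factor `n^d` (from `m` or the dimension), `1` for the
  -- coordinates in the union bound and `1` for absorbing the constant `K ≤ n`.
  set t : ℝ := β + d + 2 with ht_def
  have ht : 0 ≤ t := by positivity
  set K : ℝ := 2 * Real.exp (t ^ 2 / 2) + Real.exp 2 * 2 ^ d with hK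
  have hlog : Filter.Tendsto (fun n : ℕ => Real.log (n : ℝ)) Filter.atTop Filter.atTop :=
    Real.tendsto_log_atTop.comp tendsto_natCast_atTop_atTop
  have hev := (hlog.eventually_ge_atTop (2 * Real.exp t)).and
    (((tendsto_natCast_atTop_atTop (R := ℝ)).eventually_ge_atTop K).and
      (Filter.eventually_ge_atTop 1))
  obtain ⟨N, hN⟩ := Filter.eventually_atTop.mp hev
  refine ⟨N, fun n hn m hm => ?_⟩
  obtain ⟨hT, hnK, hn1⟩ := hN n hn
  have hn1' : (1 : ℝ) ≤ n := by exact_mod_cast hn1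
  have hn0 : (0 : ℝ) < n := by linarith
  set T := Real.log (n : ℝ) with hTdef
  have hT1 : 1 ≤ T := by linarith [Real.one_le_exp ht]
  set L : ℝ := ((n : ℝ) + 1) ^ d * (c * T) ^ (2 * d) with hL
  have hcT : 1 ≤ c * T := one_le_mul_of_one_le_of_one_le hc hT1
  have hL0 : 0 < L := by positivity
  have hn2 : ((n : ℝ) + 1) ^ d ≤ 2 ^ d * (n : ℝ) ^ d := by
    rw [← mul_pow]
    exact pow_le_pow_left₀ (by positivity) (by linarith) d
  have hmd : (m : ℝ) ≤ (n : ℝ) ^ d := by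
    rw [← Real.rpow_natCast]
    exact hm.trans (Real.rpow_le_rpow_of_exponent_le hn1' (by linarith))
  have hmL : (m : ℝ) ≤ L := by
    calc (m : ℝ) ≤ ((n : ℝ) + 1) ^ d * 1 := by
          rw [mul_one]
          exact hmd.trans (pow_le_pow_left₀ hn0.le (by linarith) d)
      _ ≤ L := mul_le_mul_of_nonneg_left (one_le_pow₀ hcT) (by positivity)
  have hgrow : (1 + 2 * L⁻¹) ^ m ≤ Real.exp 2 := by
    calc (1 + 2 * L⁻¹) ^ m ≤ (Real.exp (2 * L⁻¹)) ^ m := by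
          refine pow_le_pow_left₀ (by positivity) ?_ m
          linarith [Real.add_one_le_exp (2 * L⁻¹)]
      _ = Real.exp (m * (2 * L⁻¹)) := by rw [← Real.exp_nat_mul]
      _ ≤ Real.exp 2 := by
          refine Real.exp_le_exp.mpr ?_
          rw [show (m : ℝ) * (2 * L⁻¹) = 2 * (m / L) by ring]
          linarith [(div_le_one hL0).mpr hmL]
  have hSL : L * T ^ 2 ≤ (2 ^ d * c ^ d * T ^ (d + 1) * (n : ℝ) ^ ((d : ℝ) / 2)) ^ 2 := by
    have hsq : ((n : ℝ) ^ ((d : ℝ) / 2)) ^ 2 = (n : ℝ) ^ d := by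
      rw [← Real.rpow_natCast, ← Real.rpow_mul hn0.le, Nat.cast_ofNat, div_mul_cancel₀ _ two_ne_zero,
        Real.rpow_natCast]
    have hL2 : L ≤ 2 ^ d * (n : ℝ) ^ d * (c * T) ^ (2 * d) :=
      mul_le_mul_of_nonneg_right hn2 (by positivity)
    have h2d : (1 : ℝ) ≤ 2 ^ d := one_le_pow₀ one_le_two
    calc L * T ^ 2 ≤ (2 ^ d * (n : ℝ) ^ d) * (c * T) ^ (2 * d) * T ^ 2 := by gcongr
      _ = 1 * (2 ^ d * (n : ℝ) ^ d * (c * T) ^ (2 * d) * T ^ 2) := by ring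
      _ ≤ 2 ^ d * (2 ^ d * (n : ℝ) ^ d * (c * T) ^ (2 * d) * T ^ 2) := by gcongr
      _ = _ := by rw [mul_pow _ ((n : ℝ) ^ ((d : ℝ) / 2)), hsq]; ring
  refine le_trans (sub_le_sub_left ?_ 1) (norm_hermiteMatrix_tail (t := t) hc hT1 hH
    (le_refl L) (by positivity : 0 < T ^ 2) ht (by positivity) hSL ⌈T⌉₊)
  have hexp : Real.exp (-(t * T)) = (n : ℝ) ^ (-t) := by
    rw [Real.rpow_def_of_pos hn0, hTdef]
    congr 1
    ring
  have hpow : (n : ℝ) ^ (-t) * ((n : ℝ) ^ d * n) * n = (n : ℝ) ^ (-β) := by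
    rw [← Real.rpow_natCast (n : ℝ) d]
    nth_rewrite 3 4 [← Real.rpow_one (n : ℝ)]
    rw [← Real.rpow_add hn0, ← Real.rpow_add hn0, ← Real.rpow_add hn0]
    congr 1
    rw [ht_def]
    ring
  have hfac := factorial_ceil_div_le ht hT
  rw [hexp] at hfac
  have hpos : 0 ≤ (n : ℝ) ^ (-t) := by positivity
  have h1 : (m : ℝ) * (n * (2 * Real.exp (t ^ 2 / 2 - t * T))) ≤
      2 * Real.exp (t ^ 2 / 2) * ((n : ℝ) ^ (-t) * ((n : ℝ) ^ d * n)) := by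
    rw [sub_eq_add_neg, Real.exp_add, hexp]
    calc _ ≤ (n : ℝ) ^ d * (n * (2 * (Real.exp (t ^ 2 / 2) * (n : ℝ) ^ (-t)))) := by gcongr
      _ = _ := by ring
  have h2 : ((⌈T⌉₊).factorial : ℝ) / (T ^ 2) ^ ⌈T⌉₊ *
      ((1 + 2 * L⁻¹) ^ m * ((n : ℝ) + 1) ^ d) ≤
      Real.exp 2 * 2 ^ d * ((n : ℝ) ^ (-t) * ((n : ℝ) ^ d * n)) := by
    calc _ ≤ (n : ℝ) ^ (-t) * (Real.exp 2 * (2 ^ d * (n : ℝ) ^ d)) := by gcongr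
      _ = Real.exp 2 * 2 ^ d * ((n : ℝ) ^ (-t) * ((n : ℝ) ^ d * 1)) := by ring
      _ ≤ _ := by gcongr
  calc _ ≤ K * ((n : ℝ) ^ (-t) * ((n : ℝ) ^ d * n)) := by rw [hK]; linarith
    _ ≤ n * ((n : ℝ) ^ (-t) * ((n : ℝ) ^ d * n)) := by gcongr
    _ = _ := by rw [← hpow]; ring
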